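/- **Setting.** Let $A:[0,1]\to[0,1]$ be non-decreasing with $A(0)=0$, $A(1)=1$, and let $\hat A$ be its concave hull (least concave majorant) on $[0,1]$. Assume that $A$ is differentiable on some interval $(0,x_0)$ with a finite right derivative at $0$; that for some $\alpha\in(0,1)$ and $x_1\in(0,1]$ the derivative $A'$ exists and is $\alpha$-Hölder continuous on $[0,x_1]$; and that the right derivative $\hat A'(0)$ is finite. Put $\beta_c=\sqrt{2\log 2}/\sqrt{\hat A'(0)}$. For $N\in\mathbb N$ let $\mathbb T_N$ be the binary tree of depth $N$, $|u|$ the depth of $u\in\mathbb T_N$ and $u\wedge v$ the most recent common ancestor of $u$ and $v$. The continuous random energy model (CREM) is the centered Gaussian process $(X_u)_{u\in\mathbb T_N}$ with $\mathbb E[X_vX_w]=N\,A(|v\wedge w|/N)$, and its partition function is $Z_{\beta,N}=\sum_{|u|=N}e^{\beta X_u}$. **Proposition.** Let $0\le\beta<\beta_c$, and for $\gamma\in(11/10,2)$ and $N\in\mathbb N$, $N\ge1$, let $K=K(\gamma,N)=\lfloor 2\log_\gamma N\rfloor$. There exist $N_0=N_0(A,\beta)\in\mathbb N$, $\eta_0=\eta_0(A,\beta)\in(0,1)$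 and constants $C(A,\beta,s)>0$, $s>0$, such that for every $\gamma\in(11/10,2)$ there are sequences $(\varepsilon_k)_{k\ge0}$ and $(\eta_k)_{k\ge0}$ of positive reals, not depending on $N$ or $s$, with $\eta_k=\eta_0^{\gamma^k}$ for all $k$, both decaying to $0$ at least doubly exponentially (that is, bounded by $c_1\exp(-c_2e^{c_2k})$ for some $c_1,c_2>0$), and such that 1. for all $N\ge N_0$ and all integers $0\le k\le K$, $$\mathbb P\bigl(Z_{\beta,N}\le\varepsilon_k\,\mathbb E[Z_{\beta,N}]\bigr)\le\eta_k;$$ 2. for all $s>0$ and all $N\ge1$, $$\sum_{r=0}^{K-1}(\varepsilon_{r+1})^{-s}\,\eta_r\le C(A,\beta,s),$$ a bound that does not depend on $K$. -/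

import Mathlib

open MeasureTheory ProbabilityTheory Set

noncomputable section

namespace CREM

/-! ### The covariance profile -/

/-- The derivative of a function given on `[0,1]`: two-sided in the interior, the right derivative
at `0` and the left derivative at `1`. The values of `A` outside `[0,1]` play no role. -/
def unitDeriv (A : ℝ → ℝ) (x : ℝ) : ℝ := derivWithin A (Icc 0 1) x

/-- The concave hull of `A` on `[0,1]`: the pointwise infimum of all concave majorants. -/
def concaveHull (A : ℝ → ℝ) (x : ℝ) : ℝ :=
  sInf {y : ℝ | ∃ f : ℝ → ℝ, ConcaveOn ℝ (Icc 0 1) f ∧ (∀ t ∈ Icc (0 : ℝ) 1, A t ≤ f t) ∧ y = f x}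

/-- The right derivative at `0` of the concave hull of `A`. -/
def hullSlope (A : ℝ → ℝ) : ℝ := unitDeriv (concaveHull A) 0

/-- The standing assumptions on the covariance profile `A : [0,1] → [0,1]`. -/
structure IsProfile (A : ℝ → ℝ) : Prop where
  monotone : MonotoneOn A (Icc 0 1)
  map_zero : A 0 = 0
  map_one : A 1 = 1
  /-- `A` is differentiable near `0`, with a finite right derivative at `0`. -/
  differentiable_near_zero : ∃ x₀ ∈ Ioc (0 : ℝ) 1,
    DifferentiableOn ℝ A (Ioo 0 x₀) ∧ DifferentiableWithinAt ℝ A (Icc 0 1) 0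
  /-- The derivative of `A` is Hölder continuous near `0`, for some exponent in `(0,1)`. -/
  holder_near_zero : ∃ α ∈ Ioo (0 : ℝ) 1, ∃ x₁ ∈ Ioc (0 : ℝ) 1,
    (∀ x ∈ Icc 0 x₁, DifferentiableWithinAt ℝ A (Icc 0 1) x) ∧
    ∃ H : ℝ, ∀ x ∈ Icc 0 x₁, ∀ y ∈ Icc 0 x₁,
      |unitDeriv A x - unitDeriv A y| ≤ H * |x - y| ^ α
  /-- The concave hull has a finite right derivative at `0`. -/
  hull_differentiable_zero : DifferentiableWithinAt ℝ (concaveHull A) (Icc 0 1) 0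

/-- The static critical inverse temperature `β_c = √(2 log 2) / √(Â'(0))`. -/
def criticalBeta (A : ℝ → ℝ) : ℝ := √(2 * Real.log 2) / √(hullSlope A)

/-! ### The binary tree and the CREM -/

/-- The vertices of the binary tree of depth `N`: binary words of length at most `N`. The depth of
a vertex is its length, its ancestors are its prefixes, and the root is the empty word. -/
abbrev Tree (N : ℕ) : Type := {u : List Bool // u.length ≤ N}

/-- The longest common prefix of two words, that is, their most recent common ancestor. -/
def commonPrefix : List Bool → List Bool → List Bool
  | a :: u, b :: v => if a = b then a :: commonPrefix u v else []
  | _, _ => []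

/-- The vertex of depth `N` spelled out by `w`; these are all the vertices of depth `N`. -/
def leaf {N : ℕ} (w : Fin N → Bool) : Tree N := ⟨List.ofFn w, (List.length_ofFn).le⟩

/-- `X` is a continuous random energy model on the binary tree of depth `N` with profile `A`: a
centered Gaussian process with `E[X_v X_w] = N A(|v ∧ w| / N)`. -/
structure IsCREM (A : ℝ → ℝ) (N : ℕ) {Ω : Type*} [MeasurableSpace Ω] (P : Measure Ω)
    (X : Tree N → Ω → ℝ) : Prop where
  isGaussian : IsGaussianProcess X P
  centered : ∀ v, ∫ ω, X v ω ∂P = 0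
  covariance : ∀ v w,
    ∫ ω, X v ω * X w ω ∂P = N * A (((commonPrefix v.1 w.1).length : ℝ) / N)

/-- The partition function `Z_{β,N} = ∑_{|u| = N} exp (β X_u)`. -/
def partitionFunction {N : ℕ} {Ω : Type*} (X : Tree N → Ω → ℝ) (β : ℝ) (ω : Ω) : ℝ :=
  ∑ w : Fin N → Bool, Real.exp (β * X (leaf w) ω)

/-! ### The sequences -/

/-- The number of steps `K = ⌊2 log_γ N⌋`. -/
def numSteps (γ : ℝ) (N : ℕ) : ℕ := ⌊2 * Real.logb γ N⌋₊

/-- `u` decays to `0` at least doubly exponentially. -/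
def DecaysDoublyExponentially (u : ℕ → ℝ) : Prop :=
  ∃ C > 0, ∃ c > 0, ∀ k : ℕ, |u k| ≤ C * Real.exp (-c * Real.exp (c * k))

end CREM

end

namespace CREM

/-! ### Longest common prefixes -/

/-! A uniform lower-tail bound at constant scale is amplified by independence.

Constant scale (`exists_measureReal_le_quarter_le`): if the variance at depth `l` is at most `a * l`
and `β ^ 2 * a / 2 < log 2`, then the partition function exceeds a quarter of its mean with
probability at least some `p > 0` that depends neither on the depth of the tree nor on the variance
profile. The plain second moment may blow up before the critical point, so leaves are kept only if
their ancestral line stays below a barrier slightly above `β * V l`, its typical level under the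
Gibbs tilt. This keeps half of the mean, and a pair of leaves with overlap `l` then costs a factor
`q ^ l` with `q < 2`, which is beaten by the `2 ^ (-l)` frequency of such pairs.

Amplification (`IsTreeField.measureReal_partitionFunction_le`): the field increments in the `2 ^ k`
subtrees rooted at depth `k` are independent tree fields. For `k ≤ K = O(log N)`, their variances
still grow at a rate at most `hullSlope A + d` (`IsProfile.exists_variance_increment_le`), so the
same `p` serves them all. Either all subtrees are bad, with probability at most `(1 - p) ^ (2 ^ k)`,
or some vertex at depth `k` is very low, which a Chernoff bound controls. With a deviation of order
`(k + 1) * √γ ^ k`, both terms together are at most `(1 - p / 2) ^ (γ ^ k)`. In the final sum the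
loss `(r + 2) * √γ ^ (r + 1)` in the exponent is of lower order than the gain `γ ^ r`, uniformly for
`γ > 11 / 10`. -/

@[simp] lemma commonPrefix_nil_left (v : List Bool) : commonPrefix [] v = [] := by
  cases v <;> simp [commonPrefix]

@[simp] lemma commonPrefix_nil_right (v : List Bool) : commonPrefix v [] = [] := by
  cases v <;> simp [commonPrefix]

lemma commonPrefix_comm (u v : List Bool) : commonPrefix u v = commonPrefix v u := by
  induction u generalizing v with
  | nil => simp
  | cons a u ih =>
    cases v with
    | nil => simp
    | cons b v =>
      by_cases h : a = b
      · subst h; simp [commonPrefix, ih v]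
      · simp [commonPrefix, h, Ne.symm h]

@[simp] lemma commonPrefix_self (u : List Bool) : commonPrefix u u = u := by
  induction u with
  | nil => simp
  | cons a u ih => simp [commonPrefix, ih]

lemma commonPrefix_append_append (u v w : List Bool) :
    commonPrefix (u ++ v) (u ++ w) = u ++ commonPrefix v w := by
  induction u with
  | nil => simp
  | cons a u ih => simp [commonPrefix, ih]

lemma commonPrefix_append_left (u v : List Bool) : commonPrefix (u ++ v) u = u := by
  simpa using commonPrefix_append_append u v []

lemma commonPrefix_prefix_left (u v : List Bool) : commonPrefix u v <+: u := by
  induction u generalizing v with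
  | nil => simp
  | cons a u ih =>
    cases v with
    | nil => simp
    | cons b v =>
      by_cases h : a = b
      · subst h; simpa [commonPrefix] using ih v
      · simp [commonPrefix, h]

lemma commonPrefix_prefix_right (u v : List Bool) : commonPrefix u v <+: v :=
  commonPrefix_comm u v ▸ commonPrefix_prefix_left v u

lemma commonPrefix_eq_right_of_prefix {u v : List Bool} (h : v <+: u) : commonPrefix u v = v := by
  obtain ⟨w, rfl⟩ := h
  exact commonPrefix_append_left v w

lemma commonPrefix_eq_take (u v : List Bool) :
    commonPrefix u v = u.take (commonPrefix u v).length :=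
  List.prefix_iff_eq_take.1 (commonPrefix_prefix_left u v)

/-- Distinct words of equal length already disagree inside themselves, so continuations do not
affect the overlap. This is the source of independence between subtrees. -/
lemma commonPrefix_append_of_ne {u u' : List Bool} (hl : u.length = u'.length) (hne : u ≠ u')
    (v v' : List Bool) : commonPrefix (u ++ v) (u' ++ v') = commonPrefix u u' := by
  induction u generalizing u' with
  | nil => cases u' <;> simp_all
  | cons a u ih =>
    cases u' with
    | nil => simp at hl
    | cons b u' =>
      by_cases h : a = b
      · subst h
        simp only [List.cons_append, commonPrefix, if_true]
        rw [ih (by simpa using hl) (by simpa using hne)]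
      · simp [commonPrefix, h]

/-- The number of pairs of leaves, weighted geometrically by the depth of the branching point. -/
lemma sum_pow_commonPrefix_le {q : ℝ} (hq : 1 ≤ q) (hq2 : q < 2) (n : ℕ) (w : Fin n → Bool) :
    ∑ w' : Fin n → Bool, q ^ (commonPrefix (List.ofFn w) (List.ofFn w')).length
      ≤ 2 ^ n * (1 / (2 - q)) := by
  have h2q : 0 < 2 - q := by linarith
  induction n with
  | zero =>
    simp only [List.ofFn_zero, commonPrefix_nil_left, List.length_nil, pow_zero, Finset.sum_const,
      Finset.card_univ]
    simp only [Fintype.card_unique, one_smul, one_mul]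
    rw [le_div_iff₀ h2q]; linarith
  | succ n ih =>
    -- Condition on the first letter: agreement contributes a factor `q`, disagreement gives overlap
    -- `0`. The constant `1 / (2 - q)` is the fixed point of the resulting recursion, `q / (2 - q) +
    -- 1 = 2 / (2 - q)`.
    have key : ∀ b : Bool, ∑ w' : Fin n → Bool,
        q ^ (commonPrefix (List.ofFn w) (List.ofFn (Fin.cons b w' : Fin (n + 1) → Bool))).length
        ≤ if b = w 0 then q * (2 ^ n * (1 / (2 - q))) else 2 ^ n := by
      intro b
      by_cases h : b = w 0
      · subst h
        simp only [List.ofFn_succ, Fin.cons_zero, Fin.cons_succ, commonPrefix, if_true,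
          List.length_cons, pow_succ]
        rw [← Finset.sum_mul, mul_comm]
        exact mul_le_mul_of_nonneg_left (ih _) (by linarith)
      · simp [List.ofFn_succ, commonPrefix, h, Ne.symm h]
    rw [← (Fin.consEquiv fun _ : Fin (n + 1) => Bool).sum_comp, Fintype.sum_prod_type]
    calc _ ≤ ∑ b : Bool, if b = w 0 then q * (2 ^ n * (1 / (2 - q))) else 2 ^ n :=
          Finset.sum_le_sum fun b _ => key b
      _ = q * (2 ^ n * (1 / (2 - q))) + 2 ^ n := by
          rw [Fintype.sum_bool]
          cases w 0 <;> simp [add_comm]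
      _ = 2 ^ (n + 1) * (1 / (2 - q)) := by field_simp; ring

/-! ### Exponential moments of Gaussian processes -/

section Gaussian

variable {T Ω : Type*} [MeasurableSpace Ω] {P : Measure Ω} {X : T → Ω → ℝ}

lemma hasGaussianLaw_linearCombination (hX : IsGaussianProcess X P) {m : ℕ} (c : Fin m → ℝ)
    (t : Fin m → T) : HasGaussianLaw (fun ω => ∑ i, c i * X (t i) ω) P := by
  classical
  have : IsGaussianProcess (fun (_ : Unit) ω => ∑ i, c i * X (t i) ω) P := by
    refine hX.of_isGaussianProcess fun _ => ⟨Finset.univ.image t,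
      ∑ i, c i • ContinuousLinearMap.proj (R := ℝ) ⟨t i, by simp⟩, fun ω => ?_⟩
    simp
  exact this.hasGaussianLaw_eval ()

lemma integral_sq_linearCombination (hX : IsGaussianProcess X P) {m : ℕ} (c : Fin m → ℝ)
    (t : Fin m → T) : ∫ ω, (∑ i, c i * X (t i) ω) ^ 2 ∂P =
      ∑ i, ∑ j, c i * c j * ∫ ω, X (t i) ω * X (t j) ω ∂P := by
  have hint : ∀ i j, Integrable (fun ω => c i * c j * (X (t i) ω * X (t j) ω)) P := fun i j =>
    ((hX.hasGaussianLaw_eval (t i)).memLp_two.integrable_mul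
      (hX.hasGaussianLaw_eval (t j)).memLp_two).const_mul _
  have : ∀ ω, (∑ i, c i * X (t i) ω) ^ 2 =
      ∑ i, ∑ j, c i * c j * (X (t i) ω * X (t j) ω) := by
    intro ω
    rw [sq, Finset.sum_mul_sum]
    exact Finset.sum_congr rfl fun i _ => Finset.sum_congr rfl fun j _ => by ring
  simp_rw [this]
  rw [integral_finsetSum _ fun i _ => integrable_finsetSum _ fun j _ => hint i j]
  refine Finset.sum_congr rfl fun i _ => ?_
  rw [integral_finsetSum _ fun j _ => hint i j]
  exact Finset.sum_congr rfl fun j _ => integral_const_mul _ _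

lemma exp_moment_linearCombination (hX : IsGaussianProcess X P) (h0 : ∀ v, ∫ ω, X v ω ∂P = 0)
    {m : ℕ} (c : Fin m → ℝ) (t : Fin m → T) :
    Integrable (fun ω => Real.exp (∑ i, c i * X (t i) ω)) P ∧
    ∫ ω, Real.exp (∑ i, c i * X (t i) ω) ∂P =
      Real.exp ((∑ i, ∑ j, c i * c j * ∫ ω, X (t i) ω * X (t j) ω ∂P) / 2) := by
  have hG := hasGaussianLaw_linearCombination hX c t
  have hmean : ∫ ω, ∑ i, c i * X (t i) ω ∂P = 0 := by
    rw [integral_finsetSum _ fun i _ => (hX.hasGaussianLaw_eval (t i)).integrable.const_mul _]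
    exact Finset.sum_eq_zero fun i _ => by rw [integral_const_mul, h0, mul_zero]
  have hmap := hG.map_eq_gaussianReal
  rw [hmean] at hmap
  have hvar : Var[fun ω => ∑ i, c i * X (t i) ω; P] =
      ∑ i, ∑ j, c i * c j * ∫ ω, X (t i) ω * X (t j) ω ∂P := by
    rw [variance_of_integral_eq_zero hG.aemeasurable hmean, integral_sq_linearCombination hX]
  have hmgf := mgf_gaussianReal hmap 1
  constructor
  · have := integrable_exp_mul_gaussianReal (μ := 0)
      (v := Var[fun ω => ∑ i, c i * X (t i) ω; P].toNNReal) 1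
    rw [← hmap, integrable_map_measure (by fun_prop) hG.aemeasurable] at this
    simpa [Function.comp_def] using this
  · simpa [mgf, ← hvar, Real.coe_toNNReal _ (variance_nonneg _ _)] using hmgf

end Gaussian

/-! ### Gaussian fields on the tree -/

/-- A centered Gaussian field on the binary tree of depth `n` whose covariance at two vertices is a
function `V` of the depth of their most recent common ancestor. -/
structure IsTreeField (n : ℕ) (V : ℕ → ℝ) {Ω : Type*} [MeasurableSpace Ω] (P : Measure Ω)
    (Y : Tree n → Ω → ℝ) : Prop where
  isGaussian : IsGaussianProcess Y P
  centered : ∀ v, ∫ ω, Y v ω ∂P = 0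
  covariance : ∀ v w, ∫ ω, Y v ω * Y w ω ∂P = V (commonPrefix v.1 w.1).length

lemma IsCREM.isTreeField {A : ℝ → ℝ} {N : ℕ} {Ω : Type*} [MeasurableSpace Ω] {P : Measure Ω}
    {X : Tree N → Ω → ℝ} (h : IsCREM A N P X) :
    IsTreeField N (fun l => N * A ((l : ℝ) / N)) P X :=
  ⟨h.isGaussian, h.centered, h.covariance⟩

/-- The ancestor at depth `l` of a leaf. -/
def ancestor {n : ℕ} (w : Fin n → Bool) (l : ℕ) : Tree n :=
  ⟨(List.ofFn w).take l, by simp⟩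

/-- The depth of the most recent common ancestor of two leaves. -/
def overlap {n : ℕ} (w w' : Fin n → Bool) : ℕ := (commonPrefix (List.ofFn w) (List.ofFn w')).length

lemma overlap_le {n : ℕ} (w w' : Fin n → Bool) : overlap w w' ≤ n := by
  simpa [overlap] using (commonPrefix_prefix_left (List.ofFn w) (List.ofFn w')).length_le

namespace IsTreeField

variable {n : ℕ} {V : ℕ → ℝ} {Ω : Type*} [MeasurableSpace Ω] {P : Measure Ω} {Y : Tree n → Ω → ℝ}

lemma exp_moment_single (h : IsTreeField n V P Y) (c : ℝ) (v : Tree n) :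
    Integrable (fun ω => Real.exp (c * Y v ω)) P ∧
    ∫ ω, Real.exp (c * Y v ω) ∂P = Real.exp (c ^ 2 * V v.1.length / 2) := by
  have := exp_moment_linearCombination h.isGaussian h.centered ![c] ![v]
  simpa [h.covariance, sq] using this

lemma exp_moment_leaf_add_ancestor (h : IsTreeField n V P Y) (b c : ℝ) (w : Fin n → Bool) {l : ℕ}
    (hl : l ≤ n) :
    Integrable (fun ω => Real.exp (b * Y (leaf w) ω + c * Y (ancestor w l) ω)) P ∧
    ∫ ω, Real.exp (b * Y (leaf w) ω + c * Y (ancestor w l) ω) ∂P =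
      Real.exp (b ^ 2 * V n / 2 + b * c * V l + c ^ 2 * V l / 2) := by
  have := exp_moment_linearCombination h.isGaussian h.centered ![b, c] ![leaf w, ancestor w l]
  have h1 : commonPrefix (List.ofFn w) ((List.ofFn w).take l) = (List.ofFn w).take l :=
    commonPrefix_eq_right_of_prefix (List.take_prefix _ _)
  have h2 : commonPrefix ((List.ofFn w).take l) (List.ofFn w) = (List.ofFn w).take l := by
    rw [commonPrefix_comm, h1]
  simp only [h.covariance, Fin.sum_univ_two, Matrix.cons_val_zero, Matrix.cons_val_one, leaf,
    ancestor, commonPrefix_self, h1, h2, List.length_take, List.length_ofFn, min_eq_left hl]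
    at this
  refine ⟨this.1, this.2.trans ?_⟩
  congr 1; ring

/-- Subtracting the branching vertex removes one of the two copies of the shared path; the removed
copy is the one that the barrier bounds. -/
lemma exp_moment_pair_sub_ancestor (h : IsTreeField n V P Y) (b : ℝ) (w w' : Fin n → Bool) :
    Integrable (fun ω => Real.exp (b * Y (leaf w) ω + b * Y (leaf w') ω
      - b * Y (ancestor w (overlap w w')) ω)) P ∧
    ∫ ω, Real.exp (b * Y (leaf w) ω + b * Y (leaf w') ω
      - b * Y (ancestor w (overlap w w')) ω) ∂P =
      Real.exp (b ^ 2 * V n - b ^ 2 * V (overlap w w') / 2) := by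
  have := exp_moment_linearCombination h.isGaussian h.centered ![b, b, -b]
    ![leaf w, leaf w', ancestor w (overlap w w')]
  have ha : (ancestor w (overlap w w')).1 = commonPrefix (List.ofFn w) (List.ofFn w') :=
    (commonPrefix_eq_take _ _).symm
  have h1 := commonPrefix_eq_right_of_prefix (commonPrefix_prefix_left (List.ofFn w) (List.ofFn w'))
  have h2 := commonPrefix_eq_right_of_prefix
    (commonPrefix_prefix_right (List.ofFn w) (List.ofFn w'))
  have h3 := (commonPrefix_comm _ _).trans h1
  have h4 := (commonPrefix_comm _ _).trans h2
  have h5 : (commonPrefix (List.ofFn w') (List.ofFn w)).length = overlap w w' := by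
    rw [commonPrefix_comm, overlap]
  have h6 : (commonPrefix (List.ofFn w) (List.ofFn w')).length = overlap w w' := rfl
  simp only [h.covariance, Fin.sum_univ_three,
    Matrix.cons_val, leaf, ha, commonPrefix_self, h1, h2, h3, h4, h5, h6,
    List.length_ofFn, neg_mul, ← sub_eq_add_neg] at this
  refine ⟨this.1, this.2.trans ?_⟩
  congr 1; ring

end IsTreeField

/-! ### The truncated second moment method -/

/-- A form of the Paley-Zygmund inequality. -/
lemma measureReal_le_quarter_le {Ω : Type*} [MeasurableSpace Ω] {P : Measure Ω}
    [IsProbabilityMeasure P] {W : Ω → ℝ} (hW : Integrable W P)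
    (hW2 : Integrable (fun ω => W ω ^ 2) P) (h1 : 1 / 2 ≤ ∫ ω, W ω ∂P) {C : ℝ} (hC : 0 < C)
    (h2 : ∫ ω, W ω ^ 2 ∂P ≤ C) :
    P.real {ω | W ω ≤ 1 / 4} ≤ 1 - 1 / (16 * C) := by
  set s := {ω | W ω ≤ 1 / 4} with hs
  have hsm : NullMeasurableSet s P := nullMeasurableSet_le hW.aemeasurable aemeasurable_const
  have hind : Integrable (s.indicator (fun _ => (1 : ℝ))) P :=
    (integrable_const (1 : ℝ)).indicator₀ hsm
  -- A linearized Cauchy-Schwarz: off `s`, `W ≤ W ^ 2 / (8 * C) + 2 * C` by completing the square.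
  -- After integration the first two terms are at most `1 / 4 + 1 / 8`, which leaves `1 / 8` for the
  -- complement of `s`.
  have hpt : ∀ ω, W ω ≤ 1 / 4 + 1 / (8 * C) * W ω ^ 2 +
      2 * C * (1 - s.indicator (fun _ => (1 : ℝ)) ω) := by
    intro ω
    by_cases hω : ω ∈ s
    · have : 0 ≤ 1 / (8 * C) * W ω ^ 2 := by positivity
      have hω' : W ω ≤ 1 / 4 := hω
      simp only [Set.indicator_of_mem hω]
      linarith
    · simp only [Set.indicator_of_notMem hω]
      have : 1 / (8 * C) * W ω ^ 2 + 2 * C - W ω = (W ω - 4 * C) ^ 2 / (8 * C) := by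
        field_simp; ring
      have : 0 ≤ (W ω - 4 * C) ^ 2 / (8 * C) := by positivity
      linarith
  have hle : ∫ ω, W ω ∂P ≤ ∫ ω, (1 / 4 + 1 / (8 * C) * W ω ^ 2 +
      2 * C * (1 - s.indicator (fun _ => (1 : ℝ)) ω)) ∂P :=
    integral_mono hW (((integrable_const _).add (hW2.const_mul _)).add
      (((integrable_const _).sub hind).const_mul _)) hpt
  have hPs : ∫ ω, s.indicator (fun _ => (1 : ℝ)) ω ∂P = P.real s := by
    rw [integral_indicator₀ hsm]; simp
  have hi1 : Integrable (fun ω => 1 / (8 * C) * W ω ^ 2) P := hW2.const_mul _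
  have hi2 : Integrable (fun ω => 1 / 4 + 1 / (8 * C) * W ω ^ 2) P := (integrable_const _).add hi1
  have hi3 : Integrable (fun ω => 1 - s.indicator (fun _ => (1 : ℝ)) ω) P :=
    (integrable_const _).sub hind
  rw [integral_add hi2 (hi3.const_mul _), integral_add (integrable_const _) hi1,
    integral_const_mul, integral_const_mul, integral_sub (integrable_const _) hind, hPs] at hle
  simp only [integral_const, probReal_univ, one_smul] at hle
  have h3 : 1 / (8 * C) * ∫ ω, W ω ^ 2 ∂P ≤ 1 / 8 := by
    calc _ ≤ 1 / (8 * C) * C := by gcongr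
      _ = 1 / 8 := by field_simp
  have h4 : 1 / 8 ≤ 2 * C * (1 - P.real s) := by linarith
  have h5 : 1 / (16 * C) ≤ 1 - P.real s := by
    rw [div_le_iff₀ (by positivity)]; linarith
  linarith

section Truncation

variable {n : ℕ} {V : ℕ → ℝ} {Ω : Type*} {Y : Tree n → Ω → ℝ}

/-- The event that the field stays below the barrier `b` along the ancestral line of `w`. -/
def barrierEvent (Y : Tree n → Ω → ℝ) (b : ℕ → ℝ) (w : Fin n → Bool) : Set Ω :=
  {ω | ∀ l ∈ Finset.range (n + 1), Y (ancestor w l) ω ≤ b l}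

/-- The Gibbs weight of the leaf `w`, restricted to the barrier event. -/
noncomputable def truncWeight (Y : Tree n → Ω → ℝ) (β : ℝ) (b : ℕ → ℝ) (w : Fin n → Bool) : Ω → ℝ :=
  (barrierEvent Y b w).indicator fun ω => Real.exp (β * Y (leaf w) ω)

lemma truncWeight_nonneg (Y : Tree n → Ω → ℝ) (β : ℝ) (b : ℕ → ℝ) (w : Fin n → Bool) (ω : Ω) :
    0 ≤ truncWeight Y β b w ω :=
  Set.indicator_nonneg (fun _ _ => (Real.exp_pos _).le) _

lemma truncWeight_le (Y : Tree n → Ω → ℝ) (β : ℝ) (b : ℕ → ℝ) (w : Fin n → Bool) (ω : Ω) :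
    truncWeight Y β b w ω ≤ Real.exp (β * Y (leaf w) ω) :=
  Set.indicator_le_self' (fun _ _ => (Real.exp_pos _).le) _

/-- Only the barrier at the branching vertex is used: on the event, `exp (β * (b - Y))` there is at
least `1`. -/
lemma truncWeight_mul_le {β : ℝ} (hβ : 0 ≤ β) (b : ℕ → ℝ) (w w' : Fin n → Bool) (ω : Ω) :
    truncWeight Y β b w ω * truncWeight Y β b w' ω ≤
      Real.exp (β * b (overlap w w')) * Real.exp (β * Y (leaf w) ω + β * Y (leaf w') ω
        - β * Y (ancestor w (overlap w w')) ω) := by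
  by_cases hω : ω ∈ barrierEvent Y b w
  · have hb := hω (overlap w w') (by simpa [Nat.lt_succ_iff] using overlap_le w w')
    calc _ ≤ Real.exp (β * Y (leaf w) ω) * Real.exp (β * Y (leaf w') ω) :=
          mul_le_mul (truncWeight_le ..) (truncWeight_le ..) (truncWeight_nonneg ..)
            (Real.exp_pos _).le
      _ ≤ _ := by
          rw [← Real.exp_add, ← Real.exp_add, Real.exp_le_exp]
          nlinarith [mul_le_mul_of_nonneg_left hb hβ]
  · rw [truncWeight, Set.indicator_of_notMem hω, zero_mul]
    positivity

variable [MeasurableSpace Ω] {P : Measure Ω}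

lemma nullMeasurableSet_barrierEvent (h : IsTreeField n V P Y) (b : ℕ → ℝ) (w : Fin n → Bool) :
    NullMeasurableSet (barrierEvent Y b w) P := by
  have : barrierEvent Y b w =
      ⋂ l ∈ Finset.range (n + 1), {ω | Y (ancestor w l) ω ≤ b l} := by
    ext ω; simp [barrierEvent]
  rw [this]
  exact Finset.nullMeasurableSet_biInter _ fun l _ =>
    nullMeasurableSet_le (h.isGaussian.aemeasurable _) aemeasurable_const

lemma integrable_truncWeight (h : IsTreeField n V P Y) (β : ℝ) (b : ℕ → ℝ) (w : Fin n → Bool) :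
    Integrable (truncWeight Y β b w) P :=
  (h.exp_moment_single β (leaf w)).1.indicator₀ (nullMeasurableSet_barrierEvent h b w)

/-- Union bound over the depths, with each crossing indicator replaced by `exp (lam * (Y - b))`.
Weighting by the leaf's Gibbs factor shifts the mean of its ancestor at depth `l` to `β * V l`, so
only the excess `x l` over that level has to be paid for. -/
lemma le_integral_truncWeight (h : IsTreeField n V P Y) (β : ℝ) {lam : ℝ} (hlam : 0 ≤ lam)
    (x : ℕ → ℝ) (w : Fin n → Bool) :
    Real.exp (β ^ 2 * V n / 2) *
        (1 - ∑ l ∈ Finset.range (n + 1), Real.exp (lam ^ 2 * V l / 2 - lam * x l)) ≤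
      ∫ ω, truncWeight Y β (fun l => β * V l + x l) w ω ∂P := by
  have hexp : ∀ l ∈ Finset.range (n + 1),
      Integrable (fun ω => Real.exp (-lam * (β * V l + x l)) *
        Real.exp (β * Y (leaf w) ω + lam * Y (ancestor w l) ω)) P := fun l hl =>
    (h.exp_moment_leaf_add_ancestor β lam w (by simpa [Nat.lt_succ_iff] using hl)).1.const_mul _
  have hleaf := h.exp_moment_single β (leaf w)
  have hpt : ∀ ω, Real.exp (β * Y (leaf w) ω) -
      ∑ l ∈ Finset.range (n + 1), Real.exp (-lam * (β * V l + x l)) *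
        Real.exp (β * Y (leaf w) ω + lam * Y (ancestor w l) ω) ≤
      truncWeight Y β (fun l => β * V l + x l) w ω := by
    intro ω
    by_cases hω : ω ∈ barrierEvent Y (fun l => β * V l + x l) w
    · rw [truncWeight, Set.indicator_of_mem hω]
      have : 0 ≤ ∑ l ∈ Finset.range (n + 1), Real.exp (-lam * (β * V l + x l)) *
        Real.exp (β * Y (leaf w) ω + lam * Y (ancestor w l) ω) :=
        Finset.sum_nonneg fun l _ => by positivity
      linarith
    · rw [truncWeight, Set.indicator_of_notMem hω]
      simp only [barrierEvent, Set.mem_ofPred_eq, not_forall, not_le] at hω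
      obtain ⟨l, hl, hlt⟩ := hω
      have : Real.exp (β * Y (leaf w) ω) ≤ Real.exp (-lam * (β * V l + x l)) *
          Real.exp (β * Y (leaf w) ω + lam * Y (ancestor w l) ω) := by
        rw [← Real.exp_add, Real.exp_le_exp]
        nlinarith [mul_le_mul_of_nonneg_left hlt.le hlam]
      have := this.trans (Finset.single_le_sum (f := fun l => Real.exp (-lam * (β * V l + x l)) *
        Real.exp (β * Y (leaf w) ω + lam * Y (ancestor w l) ω)) (fun l _ => by positivity) hl)
      linarith
  have hint := integral_mono (hleaf.1.sub (integrable_finsetSum _ hexp))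
    (integrable_truncWeight h β _ w) hpt
  simp only [Pi.sub_apply] at hint
  rw [integral_sub hleaf.1 (integrable_finsetSum _ hexp), integral_finsetSum _ hexp, hleaf.2] at hint
  refine le_of_eq_of_le ?_ hint
  rw [mul_sub, mul_one, Finset.mul_sum]
  congr 1
  · simp [leaf]
  · refine Finset.sum_congr rfl fun l hl => ?_
    rw [integral_const_mul, (h.exp_moment_leaf_add_ancestor β lam w
      (by simpa [Nat.lt_succ_iff] using hl)).2, ← Real.exp_add, ← Real.exp_add]
    congr 1; ring

lemma integrable_truncWeight_mul (h : IsTreeField n V P Y) {β : ℝ} (hβ : 0 ≤ β) (b : ℕ → ℝ)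
    (w w' : Fin n → Bool) :
    Integrable (fun ω => truncWeight Y β b w ω * truncWeight Y β b w' ω) P := by
  refine ((h.exp_moment_pair_sub_ancestor β w w').1.const_mul
    (Real.exp (β * b (overlap w w')))).mono'
    ((integrable_truncWeight h β b w).aestronglyMeasurable.mul
      (integrable_truncWeight h β b w').aestronglyMeasurable) (.of_forall fun ω => ?_)
  rw [Real.norm_of_nonneg (mul_nonneg (truncWeight_nonneg ..) (truncWeight_nonneg ..))]
  exact truncWeight_mul_le hβ b w w' ω

lemma integral_truncWeight_mul_le (h : IsTreeField n V P Y) {β : ℝ} (hβ : 0 ≤ β) (b : ℕ → ℝ)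
    (w w' : Fin n → Bool) :
    ∫ ω, truncWeight Y β b w ω * truncWeight Y β b w' ω ∂P ≤
      Real.exp (β ^ 2 * V n) *
        Real.exp (β * b (overlap w w') - β ^ 2 * V (overlap w w') / 2) := by
  refine (integral_mono (integrable_truncWeight_mul h hβ b w w')
    ((h.exp_moment_pair_sub_ancestor β w w').1.const_mul _)
    (truncWeight_mul_le hβ b w w')).trans_eq ?_
  rw [integral_const_mul, (h.exp_moment_pair_sub_ancestor β w w').2, ← Real.exp_add,
    ← Real.exp_add]
  congr 1; ring

lemma sum_exp_neg_mul_le {r c : ℝ} (hr : 0 < r)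
    (hc : Real.log (2 / (1 - Real.exp (-r))) ≤ c) (n : ℕ) :
    ∑ l ∈ Finset.range n, Real.exp (-(r * l) - c) ≤ 1 / 2 := by
  have hlt : Real.exp (-r) < 1 := by simpa using hr
  have hpos : 0 < 1 - Real.exp (-r) := by linarith
  have h1 : ∀ l ∈ Finset.range n, Real.exp (-(r * l) - c) =
      Real.exp (-c) * Real.exp (-r) ^ l := by
    intro l _
    rw [← Real.exp_nat_mul, ← Real.exp_add]; congr 1; ring
  rw [Finset.sum_congr rfl h1, ← Finset.mul_sum]
  have h2 : ∑ l ∈ Finset.range n, Real.exp (-r) ^ l ≤ (1 - Real.exp (-r))⁻¹ := by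
    rw [← tsum_geometric_of_lt_one (Real.exp_pos _).le hlt]
    exact (summable_geometric_of_lt_one (Real.exp_pos _).le hlt).sum_le_tsum _
      fun _ _ => by positivity
  have h3 : Real.exp (-c) ≤ (1 - Real.exp (-r)) / 2 := by
    calc Real.exp (-c) ≤ Real.exp (-Real.log (2 / (1 - Real.exp (-r)))) := by gcongr
      _ = (1 - Real.exp (-r)) / 2 := by rw [Real.exp_neg, Real.exp_log (by positivity), inv_div]
  calc _ ≤ (1 - Real.exp (-r)) / 2 * (1 - Real.exp (-r))⁻¹ := by gcongr
    _ = 1 / 2 := by field_simp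

/-- In the subcritical regime the normalized partition function of a tree field is bounded away
from zero with a probability that only depends on the parameters. -/
theorem exists_measureReal_le_quarter_le {β a δ : ℝ} (hβ : 0 ≤ β) (ha : 0 < a) (hδ : 0 < δ)
    (hsub : β ^ 2 * a / 2 + β * δ < Real.log 2) :
    ∃ p ∈ Ioo (0 : ℝ) 1, ∀ (n : ℕ) (V : ℕ → ℝ) (Ω : Type*) [MeasurableSpace Ω] (P : Measure Ω)
      [IsProbabilityMeasure P] (Y : Tree n → Ω → ℝ), IsTreeField n V P Y →
      (∀ l ≤ n, V l ≤ a * l) →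
      P.real {ω | partitionFunction Y β ω ≤
        1 / 4 * (2 ^ n * Real.exp (β ^ 2 * V n / 2))} ≤ 1 - p := by
  -- The minimizer of `lam ^ 2 * a / 2 - lam * δ`, whose minimum is `-r` below. The offset `B` makes
  -- the geometric series of crossing probabilities at most `1 / 2`; the absolute value ensures `B ≥
  -- 0`.
  set lam := δ / a with hlam
  have hlam0 : 0 < lam := by positivity
  set r := δ ^ 2 / (2 * a) with hr
  have hr0 : 0 < r := by positivity
  set B := |Real.log (2 / (1 - Real.exp (-r)))| / lam with hB
  have hB0 : 0 ≤ B := by positivity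
  have hlamB : Real.log (2 / (1 - Real.exp (-r))) ≤ lam * B := by
    rw [hB, mul_div_cancel₀ _ hlam0.ne']; exact le_abs_self _
  -- The cost per generation of overlap; `q < 2` is exactly the subcriticality hypothesis.
  set q := Real.exp (β ^ 2 * a / 2 + β * δ) with hq
  have hq1 : 1 ≤ q := Real.one_le_exp (by positivity)
  have hq2 : q < 2 := by
    simpa [hq, Real.exp_log] using Real.exp_lt_exp.2 hsub
  have h2q : 0 < 2 - q := by linarith
  set C := Real.exp (β * B) * (1 / (2 - q)) with hC
  have hC1 : 1 ≤ C := by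
    have h1 : 1 ≤ Real.exp (β * B) := Real.one_le_exp (by positivity)
    have h2 : 1 ≤ 1 / (2 - q) := by rw [le_div_iff₀ h2q]; linarith
    nlinarith
  have hC0 : 0 < C := by linarith
  refine ⟨1 / (16 * C), ⟨by positivity, by rw [div_lt_one (by positivity)]; linarith⟩, ?_⟩
  intro n V Ω _ P _ Y h hV
  set x : ℕ → ℝ := fun l => δ * l + B with hx
  set b : ℕ → ℝ := fun l => β * V l + x l with hb
  set E := Real.exp (β ^ 2 * V n / 2) with hE
  have hE0 : 0 < E := Real.exp_pos _
  set M := (2 ^ n * E)⁻¹ with hM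
  have hM0 : 0 < M := by positivity
  let W : Ω → ℝ := fun ω => M * ∑ w : Fin n → Bool, truncWeight Y β b w ω
  have hWle : ∀ ω, W ω ≤ M * ∑ w : Fin n → Bool, Real.exp (β * Y (leaf w) ω) := fun ω =>
    mul_le_mul_of_nonneg_left (Finset.sum_le_sum fun w _ => truncWeight_le ..) hM0.le
  have hWint : Integrable W P :=
    (integrable_finsetSum _ fun w _ => integrable_truncWeight h β b w).const_mul M
  have hW2eq : ∀ ω, W ω ^ 2 = M ^ 2 * ∑ w : Fin n → Bool, ∑ w' : Fin n → Bool,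
      truncWeight Y β b w ω * truncWeight Y β b w' ω := by
    intro ω
    simp only [W]
    rw [mul_pow, sq (∑ w : Fin n → Bool, _), Finset.sum_mul_sum]
  have hint2 : ∀ w w' : Fin n → Bool, Integrable (fun ω =>
      truncWeight Y β b w ω * truncWeight Y β b w' ω) P := integrable_truncWeight_mul h hβ b
  have hW2int : Integrable (fun ω => W ω ^ 2) P := by
    simp_rw [hW2eq]
    exact (integrable_finsetSum _ fun w _ => integrable_finsetSum _ fun w' _ =>
      hint2 w w').const_mul _
  have hfirst : 1 / 2 ≤ ∫ ω, W ω ∂P := by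
    have hw : ∀ w : Fin n → Bool, E * (1 / 2) ≤ ∫ ω, truncWeight Y β b w ω ∂P := by
      intro w
      refine le_trans ?_ (le_integral_truncWeight h β hlam0.le x w)
      refine mul_le_mul_of_nonneg_left ?_ hE0.le
      have : ∑ l ∈ Finset.range (n + 1), Real.exp (lam ^ 2 * V l / 2 - lam * x l) ≤ 1 / 2 := by
        refine le_trans (Finset.sum_le_sum fun l hl => ?_)
          (sum_exp_neg_mul_le hr0 hlamB (n + 1))
        have hVl := hV l (by simpa [Nat.lt_succ_iff] using hl)
        rw [Real.exp_le_exp]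
        have h1 : lam ^ 2 * V l / 2 ≤ lam ^ 2 * (a * l) / 2 := by gcongr
        have h2 : lam ^ 2 * (a * l) / 2 - lam * (δ * l) = -(r * l) := by
          rw [hlam, hr]; field_simp; ring
        simp only [hx]
        linarith
      linarith
    simp only [W]
    rw [integral_const_mul, integral_finsetSum _ fun w _ => integrable_truncWeight h β b w]
    calc 1 / 2 = M * ∑ w : Fin n → Bool, E * (1 / 2) := by
          simp only [Finset.sum_const, Finset.card_univ, Fintype.card_fun, Fintype.card_bool,
            Fintype.card_fin, nsmul_eq_mul, hM]
          push_cast; field_simp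
      _ ≤ _ := mul_le_mul_of_nonneg_left (Finset.sum_le_sum fun w _ => hw w) hM0.le
  have hsecond : ∫ ω, W ω ^ 2 ∂P ≤ C := by
    have hw : ∀ w w' : Fin n → Bool, ∫ ω, truncWeight Y β b w ω * truncWeight Y β b w' ω ∂P ≤
        E ^ 2 * Real.exp (β * B) * q ^ overlap w w' := by
      intro w w'
      refine (integral_truncWeight_mul_le h hβ b w w').trans ?_
      rw [hE, hq, ← Real.exp_nat_mul, ← Real.exp_nat_mul, ← Real.exp_add, ← Real.exp_add,
        ← Real.exp_add, Real.exp_le_exp]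
      have := mul_le_mul_of_nonneg_left (hV _ (overlap_le w w')) (sq_nonneg β)
      simp only [hb, hx]
      push_cast
      nlinarith
    simp_rw [hW2eq]
    rw [integral_const_mul, integral_finsetSum _ fun w _ => integrable_finsetSum _ fun w' _ =>
      hint2 w w']
    simp_rw [integral_finsetSum _ fun w' _ => hint2 _ w']
    calc _ ≤ M ^ 2 * ∑ w : Fin n → Bool, E ^ 2 * Real.exp (β * B) * (2 ^ n * (1 / (2 - q))) := by
          refine mul_le_mul_of_nonneg_left (Finset.sum_le_sum fun w _ => ?_) (sq_nonneg M)
          refine (Finset.sum_le_sum fun w' _ => hw w w').trans ?_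
          rw [← Finset.mul_sum]
          exact mul_le_mul_of_nonneg_left (sum_pow_commonPrefix_le hq1 hq2 n w) (by positivity)
      _ = C := by
          simp only [Finset.sum_const, Finset.card_univ, Fintype.card_fun, Fintype.card_bool,
            Fintype.card_fin, nsmul_eq_mul, hM, hC]
          push_cast; field_simp
  refine (measureReal_mono (fun ω hω => ?_)).trans
    (measureReal_le_quarter_le hWint hW2int hfirst hC0 hsecond)
  have hω' : ∑ w : Fin n → Bool, Real.exp (β * Y (leaf w) ω) ≤ 1 / 4 * (2 ^ n * E) := hω
  refine (hWle ω).trans ((mul_le_mul_of_nonneg_left hω' hM0.le).trans_eq ?_)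
  rw [hM]; field_simp

end Truncation

/-! ### The covariance profile near the root -/

section Profile

open Filter Topology

variable {A : ℝ → ℝ}

lemma neBot_nhdsWithin_Icc_diff : (𝓝[Icc (0 : ℝ) 1 \ {0}] 0).NeBot := by
  rw [Icc_sdiff_left, nhdsWithin_Ioc_eq_nhdsGT one_pos]
  infer_instance

/-- Differentiability at `0` bounds `A` linearly near `0`, and `A ≤ 1` does so away from `0`. The
resulting linear majorant vanishes at `0`. -/
lemma IsProfile.concaveHull_zero_le (hA : IsProfile A) : concaveHull A 0 ≤ 0 := by
  obtain ⟨x₀, -, -, hd⟩ := hA.differentiable_near_zero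
  obtain ⟨c, hc⟩ := hd.hasDerivWithinAt.isBigO_sub.bound
  rw [Filter.prod_pure, Filter.eventually_map] at hc
  obtain ⟨e, he, hball⟩ := Metric.mem_nhdsWithin_iff.1 hc
  have hlin : ∀ t ∈ Icc (0 : ℝ) 1, A t ≤ (|c| + 1 / e) * t := by
    intro t ht
    by_cases hte : t < e
    · have hmem := hball ⟨show t ∈ Metric.ball 0 e by simpa [abs_of_nonneg ht.1] using hte, ht⟩
      simp only [Set.mem_ofPred_eq, hA.map_zero, sub_zero, Real.norm_eq_abs,
        abs_of_nonneg ht.1] at hmem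
      have h1 : c * t ≤ |c| * t := mul_le_mul_of_nonneg_right (le_abs_self c) ht.1
      have h2 : 0 ≤ 1 / e * t := mul_nonneg (by positivity) ht.1
      linarith [le_abs_self (A t)]
    · have h1 : A t ≤ 1 := hA.map_one ▸ hA.monotone ht (by simp) ht.2
      have h2 : 1 ≤ 1 / e * t := by
        rw [one_div, inv_mul_eq_div, le_div_iff₀ he]; linarith
      nlinarith [mul_nonneg (abs_nonneg c) ht.1]
  refine csInf_le ⟨0, ?_⟩ ⟨fun t => (|c| + 1 / e) * t, ?_, hlin, by simp⟩
  · rintro y ⟨f, -, hf, rfl⟩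
    simpa [hA.map_zero] using hf 0 (by simp)
  · exact (LinearMap.mulLeft ℝ (|c| + 1 / e)).concaveOn (convex_Icc _ _)

/-- Every concave majorant is nonnegative at `0` and at least `A x` at `x`, hence lies above the
chord joining the origin to `(x, A x)`. -/
lemma IsProfile.mul_le_concaveHull (hA : IsProfile A) {x t : ℝ} (hx : x ∈ Ioc (0 : ℝ) 1)
    (ht : t ∈ Icc 0 x) : A x / x * t ≤ concaveHull A t := by
  refine le_csInf ⟨1, fun _ => 1, concaveOn_const _ (convex_Icc _ _), fun s hs =>
    hA.map_one ▸ hA.monotone hs (by simp) hs.2, rfl⟩ ?_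
  rintro y ⟨f, hf, hle, rfl⟩
  have hx0 := hx.1
  have h01 : (0 : ℝ) ≤ 1 - t / x := by
    rw [sub_nonneg, div_le_one hx0]; exact ht.2
  have h := hf.2 (show (0 : ℝ) ∈ Icc (0 : ℝ) 1 by simp) (Ioc_subset_Icc_self hx) h01
    (div_nonneg ht.1 hx0.le) (by ring)
  simp only [smul_eq_mul, mul_zero, zero_add, div_mul_cancel₀ t hx0.ne'] at h
  have h1 : 0 ≤ f 0 := by simpa [hA.map_zero] using hle 0 (by simp)
  have h2 := mul_le_mul_of_nonneg_left (hle x (Ioc_subset_Icc_self hx))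
    (div_nonneg ht.1 hx0.le)
  calc A x / x * t = t / x * A x := by ring
    _ ≤ f t := by nlinarith [mul_nonneg h01 h1]

/-- The profile lies below the tangent at `0` of its concave hull. -/
lemma IsProfile.le_hullSlope_mul (hA : IsProfile A) {x : ℝ} (hx : x ∈ Icc (0 : ℝ) 1) :
    A x ≤ hullSlope A * x := by
  rcases hx.1.eq_or_lt with rfl | hx0
  · simp [hA.map_zero]
  have hlim := hasDerivWithinAt_iff_tendsto_slope.1 hA.hull_differentiable_zero.hasDerivWithinAt
  have := neBot_nhdsWithin_Icc_diff
  have hev : ∀ᶠ t in 𝓝[Icc (0 : ℝ) 1 \ {0}] 0, A x / x ≤ slope (concaveHull A) 0 t := by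
    have h1 : ∀ᶠ t in 𝓝[Icc (0 : ℝ) 1 \ {0}] 0, t < x := nhdsWithin_le_nhds (Iio_mem_nhds hx0)
    filter_upwards [h1, self_mem_nhdsWithin] with t htx ht
    have ht0 : 0 < t := lt_of_le_of_ne ht.1.1 (Ne.symm ht.2)
    rw [slope_def_field, sub_zero, le_div_iff₀ ht0]
    have := hA.mul_le_concaveHull ⟨hx0, hx.2⟩ ⟨ht0.le, htx.le⟩
    linarith [hA.concaveHull_zero_le]
  exact (div_le_iff₀ hx0).1 (ge_of_tendsto hlim hev)

lemma IsProfile.one_le_hullSlope (hA : IsProfile A) : 1 ≤ hullSlope A := by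
  simpa [hA.map_one] using hA.le_hullSlope_mul (x := 1) (by simp)

lemma IsProfile.nonneg (hA : IsProfile A) {x : ℝ} (hx : x ∈ Icc (0 : ℝ) 1) : 0 ≤ A x :=
  hA.map_zero ▸ hA.monotone (by simp) hx hx.1

lemma IsProfile.unitDeriv_zero_le (hA : IsProfile A) : unitDeriv A 0 ≤ hullSlope A := by
  obtain ⟨x₀, -, -, hd⟩ := hA.differentiable_near_zero
  have hlim := hasDerivWithinAt_iff_tendsto_slope.1 hd.hasDerivWithinAt
  have := neBot_nhdsWithin_Icc_diff
  refine le_of_tendsto hlim ?_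
  filter_upwards [self_mem_nhdsWithin] with t ht
  have ht0 : 0 < t := lt_of_le_of_ne ht.1.1 (Ne.symm ht.2)
  rw [slope_def_field, sub_zero, hA.map_zero, sub_zero, div_le_iff₀ ht0]
  exact hA.le_hullSlope_mul ht.1

/-- Near `0` the increments of the profile are controlled by the slope of the hull. -/
lemma IsProfile.exists_increment_le (hA : IsProfile A) {d : ℝ} (hd : 0 < d) :
    ∃ x₂ ∈ Ioc (0 : ℝ) 1, ∀ x ∈ Icc 0 x₂, ∀ y ∈ Icc 0 x₂, x ≤ y →
      A y - A x ≤ (hullSlope A + d) * (y - x) := by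
  obtain ⟨α, hα, x₁, hx₁, hdiff, H, hH⟩ := hA.holder_near_zero
  -- Chosen so that `H * x ^ α ≤ d` for `x ≤ z`: there the derivative exceeds its value at `0` by at
  -- most `d`, and the mean value inequality applies.
  set z := (d / (|H| + 1)) ^ (1 / α) with hz
  have hz0 : 0 < z := by positivity
  have hx₂ : min x₁ z ∈ Ioc (0 : ℝ) 1 := ⟨lt_min hx₁.1 hz0, (min_le_left _ _).trans hx₁.2⟩
  refine ⟨min x₁ z, hx₂, ?_⟩
  have hsub : ∀ x ∈ Icc 0 (min x₁ z), x ∈ Icc 0 x₁ := fun x hx =>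
    ⟨hx.1, hx.2.trans (min_le_left _ _)⟩
  have hnhds : ∀ x ∈ interior (Icc 0 (min x₁ z)), Icc (0 : ℝ) 1 ∈ 𝓝 x := by
    intro x hx
    rw [interior_Icc] at hx
    exact Icc_mem_nhds hx.1 (hx.2.trans_le hx₂.2)
  refine Convex.image_sub_le_mul_sub_of_deriv_le (convex_Icc _ _) (fun x hx => ?_)
    (fun x hx => ?_) (fun x hx => ?_)
  · exact ((hdiff x (hsub x hx)).continuousWithinAt).mono
      (Icc_subset_Icc_right hx₂.2)
  · exact ((hdiff x (hsub x (interior_subset hx))).differentiableAt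
      (hnhds x hx)).differentiableWithinAt
  · have hx' := interior_subset hx
    have h1 := hH x (hsub x hx') 0 ⟨le_rfl, hx₁.1.le⟩
    rw [sub_zero, abs_of_nonneg hx'.1] at h1
    have h2 : x ^ α ≤ d / (|H| + 1) := by
      calc x ^ α ≤ z ^ α :=
            Real.rpow_le_rpow hx'.1 (hx'.2.trans (min_le_right _ _)) hα.1.le
        _ = d / (|H| + 1) := by
            rw [hz, ← Real.rpow_mul (by positivity), one_div_mul_cancel hα.1.ne', Real.rpow_one]
    have h3 : H * x ^ α ≤ d := by
      calc H * x ^ α ≤ (|H| + 1) * x ^ α :=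
            mul_le_mul_of_nonneg_right (by linarith [le_abs_self H]) (Real.rpow_nonneg hx'.1 _)
        _ ≤ (|H| + 1) * (d / (|H| + 1)) := by gcongr
        _ = d := by field_simp
    have h4 : unitDeriv A x = deriv A x := derivWithin_of_mem_nhds (hnhds x hx)
    have h5 := le_abs_self (unitDeriv A x - unitDeriv A 0)
    linarith [hA.unitDeriv_zero_le]

lemma exists_numSteps_le {ρ : ℝ} (hρ : 0 < ρ) :
    ∃ N₀ : ℕ, 1 ≤ N₀ ∧ ∀ N, N₀ ≤ N → ∀ γ : ℝ, 11 / 10 < γ → (numSteps γ N : ℝ) ≤ ρ * N := by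
  have hlog : 0 < Real.log (11 / 10) := Real.log_pos (by norm_num)
  have ho := (Real.isLittleO_log_id_atTop.bound
    (show 0 < ρ * Real.log (11 / 10) / 2 by positivity))
  obtain ⟨N₀, hN₀⟩ := eventually_atTop.1 (tendsto_natCast_atTop_atTop.eventually ho)
  refine ⟨max N₀ 1, le_max_right _ _, fun N hN γ hγ => ?_⟩
  have hN1 : (1 : ℝ) ≤ N := by exact_mod_cast (le_max_right _ _).trans hN
  have h1 := hN₀ N ((le_max_left _ _).trans hN)
  have hlogN : 0 ≤ Real.log N := Real.log_nonneg hN1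
  simp only [id, Real.norm_eq_abs, abs_of_nonneg hlogN, abs_of_nonneg (zero_le_one.trans hN1)]
    at h1
  have hγlog : Real.log (11 / 10) ≤ Real.log γ := Real.log_le_log (by norm_num) hγ.le
  have hnn : 0 ≤ 2 * Real.logb γ N := by
    rw [Real.logb]
    exact mul_nonneg zero_le_two (div_nonneg hlogN (hlog.le.trans hγlog))
  refine (Nat.floor_le hnn).trans ?_
  calc 2 * Real.logb γ N ≤ 2 * (Real.log N / Real.log (11 / 10)) := by
        rw [Real.logb]; gcongr
    _ ≤ 2 * (ρ * Real.log (11 / 10) / 2 * N / Real.log (11 / 10)) := by gcongr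
    _ = ρ * N := by field_simp

/-- Below the first `K(γ, N)` generations the variance still grows at most linearly, with a rate
arbitrarily close to the slope of the hull. -/
lemma IsProfile.exists_variance_increment_le (hA : IsProfile A) {d : ℝ} (hd : 0 < d) :
    ∃ N₀ : ℕ, 1 ≤ N₀ ∧ ∀ N, N₀ ≤ N → ∀ γ : ℝ, 11 / 10 < γ → ∀ k ≤ numSteps γ N,
      k ≤ N ∧ ∀ l : ℕ, k + l ≤ N →
        N * A (((k + l : ℕ) : ℝ) / N) - N * A ((k : ℝ) / N) ≤ (hullSlope A + d) * l := by
  obtain ⟨x₂, hx₂, hinc⟩ := hA.exists_increment_le hd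
  have ha := hA.one_le_hullSlope
  set a := hullSlope A with hadef
  have hx₂0 := hx₂.1
  -- If the endpoint lies beyond `x₂`, the increment is at most `a * (k + l)`, and this is at most
  -- `(a + d) * l` as soon as `(a + d) * k ≤ d * (k + l)`. Since `k + l > x₂ * N`, it suffices that
  -- `k ≤ ρ * N`.
  set ρ := d * x₂ / (a + d) with hρ
  have hρ0 : 0 < ρ := by positivity
  have hρ1 : ρ ≤ 1 := by
    rw [hρ, div_le_one (by positivity)]
    nlinarith [hx₂.2]
  obtain ⟨N₀, hN₀, hK⟩ := exists_numSteps_le hρ0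
  refine ⟨N₀, hN₀, fun N hN γ hγ k hk => ?_⟩
  have hN0 : (0 : ℝ) < N := by exact_mod_cast hN₀.trans hN
  have hkρ : (k : ℝ) ≤ ρ * N := (by exact_mod_cast hk : (k : ℝ) ≤ numSteps γ N).trans (hK N hN γ hγ)
  have hkN : (k : ℝ) ≤ N := hkρ.trans (by nlinarith)
  refine ⟨by exact_mod_cast hkN, fun l hl => ?_⟩
  have hlN : ((k + l : ℕ) : ℝ) ≤ N := by exact_mod_cast hl
  have hk1 : (k : ℝ) / N ∈ Icc (0 : ℝ) 1 := ⟨by positivity, (div_le_one hN0).2 hkN⟩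
  have hl1 : ((k + l : ℕ) : ℝ) / N ∈ Icc (0 : ℝ) 1 := ⟨by positivity, (div_le_one hN0).2 hlN⟩
  have hle : (k : ℝ) / N ≤ ((k + l : ℕ) : ℝ) / N := by gcongr; omega
  rw [← mul_sub]
  by_cases hx : ((k + l : ℕ) : ℝ) / N ≤ x₂
  · calc _ ≤ N * ((a + d) * (((k + l : ℕ) : ℝ) / N - (k : ℝ) / N)) :=
          mul_le_mul_of_nonneg_left (hinc _ ⟨hk1.1, hle.trans hx⟩ _ ⟨hl1.1, hx⟩ hle) hN0.le
      _ = (a + d) * l := by push_cast; field_simp; ring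
  · rw [not_le, lt_div_iff₀ hN0] at hx
    have h1 : (a + d) * k ≤ d * (x₂ * N) := by
      calc (a + d) * k ≤ (a + d) * (ρ * N) := by gcongr
        _ = d * (x₂ * N) := by rw [hρ]; field_simp
    have h2 : d * (x₂ * N) ≤ d * ((k + l : ℕ) : ℝ) := by gcongr
    calc _ ≤ N * (a * (((k + l : ℕ) : ℝ) / N) - 0) := by
          gcongr
          · exact hA.le_hullSlope_mul hl1
          · exact hA.nonneg hk1
      _ = a * ((k + l : ℕ) : ℝ) := by field_simp; ring
      _ ≤ (a + d) * l := by push_cast at h2 ⊢; linarith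

end Profile

/-! ### Subtrees and one-step branching -/

/-- The vertex reached by following `v` from the vertex `u` of depth `k`. -/
def graft {k n : ℕ} (u : Fin k → Bool) (v : Tree n) : Tree (k + n) :=
  ⟨List.ofFn u ++ v.1, by simpa using v.2⟩

/-- The root of the tree. -/
def root (n : ℕ) : Tree n := ⟨[], Nat.zero_le n⟩

/-- The increments of the field inside the subtree attached to the vertex `u`. -/
def subtreeField {k n : ℕ} {Ω : Type*} (X : Tree (k + n) → Ω → ℝ) (u : Fin k → Bool) (v : Tree n)
    (ω : Ω) : ℝ :=
  X (graft u v) ω - X (graft u (root n)) ω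

lemma graft_leaf {k n : ℕ} (u : Fin k → Bool) (w : Fin n → Bool) :
    graft u (leaf w : Tree n) = leaf (Fin.append u w) := by
  simp [graft, leaf, List.ofFn_fin_append]

lemma partitionFunction_eq_sum_subtree {k n : ℕ} {Ω : Type*} (X : Tree (k + n) → Ω → ℝ) (β : ℝ)
    (ω : Ω) : partitionFunction X β ω = ∑ u : Fin k → Bool,
      Real.exp (β * X (graft u (root n)) ω) * partitionFunction (subtreeField X u) β ω := by
  rw [partitionFunction, ← (Fin.appendEquiv k n).sum_comp, Fintype.sum_prod_type]
  refine Finset.sum_congr rfl fun u _ => ?_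
  rw [partitionFunction, Finset.mul_sum]
  refine Finset.sum_congr rfl fun w _ => ?_
  rw [← Real.exp_add, subtreeField, graft_leaf]
  congr 1
  simp only [Fin.appendEquiv, Equiv.coe_fn_mk]
  ring

lemma integral_sub_mul_sub {T Ω : Type*} [MeasurableSpace Ω] {P : Measure Ω} {X : T → Ω → ℝ}
    (hX : IsGaussianProcess X P) (a b c d : T) :
    ∫ ω, (X a ω - X b ω) * (X c ω - X d ω) ∂P =
      ∫ ω, X a ω * X c ω ∂P - ∫ ω, X a ω * X d ω ∂P - ∫ ω, X b ω * X c ω ∂P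
        + ∫ ω, X b ω * X d ω ∂P := by
  have hi : ∀ s t, Integrable (fun ω => X s ω * X t ω) P := fun s t =>
    (hX.hasGaussianLaw_eval s).memLp_two.integrable_mul (hX.hasGaussianLaw_eval t).memLp_two
  have : ∀ ω, (X a ω - X b ω) * (X c ω - X d ω) =
      X a ω * X c ω - X a ω * X d ω - X b ω * X c ω + X b ω * X d ω := fun ω => by ring
  simp_rw [this]
  have h1 : Integrable (fun ω => X a ω * X c ω - X a ω * X d ω) P := (hi a c).sub (hi a d)
  have h2 : Integrable (fun ω => X a ω * X c ω - X a ω * X d ω - X b ω * X c ω) P := h1.sub (hi b c)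
  rw [integral_add h2 (hi b d), integral_sub h1 (hi b c), integral_sub (hi a c) (hi a d)]

section Subtree

variable {k n : ℕ} {V : ℕ → ℝ} {Ω : Type*} [MeasurableSpace Ω] {P : Measure Ω}
  {X : Tree (k + n) → Ω → ℝ}

lemma isGaussianProcess_subtreeField (hX : IsGaussianProcess X P) :
    IsGaussianProcess (fun (p : (_ : Fin k → Bool) × Tree n) ω => subtreeField X p.1 p.2 ω) P := by
  classical
  refine hX.of_isGaussianProcess fun p => ⟨{graft p.1 p.2, graft p.1 (root n)},
    ContinuousLinearMap.proj (R := ℝ) ⟨graft p.1 p.2, by simp⟩ -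
      ContinuousLinearMap.proj (R := ℝ) ⟨graft p.1 (root n), by simp⟩, fun ω => ?_⟩
  simp [subtreeField]

lemma IsTreeField.integral_subtreeField (h : IsTreeField (k + n) V P X) (u : Fin k → Bool)
    (v : Tree n) : ∫ ω, subtreeField X u v ω ∂P = 0 := by
  simp only [subtreeField]
  rw [integral_sub (h.isGaussian.hasGaussianLaw_eval _).integrable
    (h.isGaussian.hasGaussianLaw_eval _).integrable, h.centered, h.centered, sub_zero]

lemma IsTreeField.subtreeField (h : IsTreeField (k + n) V P X) (u : Fin k → Bool) :
    IsTreeField n (fun l => V (k + l) - V k) P (subtreeField X u) where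
  isGaussian := (isGaussianProcess_subtreeField h.isGaussian).comp_right fun v => ⟨u, v⟩
  centered := h.integral_subtreeField u
  covariance v w := by
    simp only [CREM.subtreeField]
    rw [integral_sub_mul_sub h.isGaussian]
    simp only [h.covariance, graft, root, commonPrefix_append_append, commonPrefix_nil_left,
      commonPrefix_nil_right, List.length_append, List.length_ofFn, List.length_nil, add_zero]
    ring

/-- Across two distinct subtrees, all four covariances in the expansion equal `V` at the overlap of
their roots and cancel; for jointly Gaussian families, zero covariance gives independence. -/
lemma IsTreeField.iIndepFun_subtreeField (h : IsTreeField (k + n) V P X) :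
    iIndepFun (fun (u : Fin k → Bool) ω (v : Tree n) => CREM.subtreeField X u v ω) P := by
  refine (isGaussianProcess_subtreeField h.isGaussian).iIndepFun_of_covariance_eq_zero
    (fun u v => (h.subtreeField u).isGaussian.aemeasurable v) fun u u' hu v v' => ?_
  have hne : List.ofFn u ≠ List.ofFn u' := fun he => hu (List.ofFn_injective he)
  have hl : (List.ofFn u).length = (List.ofFn u').length := by simp
  simp only [ProbabilityTheory.covariance, h.integral_subtreeField, sub_zero]
  simp only [CREM.subtreeField]
  rw [integral_sub_mul_sub h.isGaussian]
  simp only [h.covariance, graft, root, commonPrefix_append_of_ne hl hne]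
  ring

lemma measurable_sum_exp_leaf (β : ℝ) :
    Measurable fun y : Tree n → ℝ => ∑ w : Fin n → Bool, Real.exp (β * y (leaf w)) := by
  fun_prop

/-- If the partition function of the field is small, then either some vertex at depth `k` has an
exceptionally low value, or all the independent subtrees at depth `k` have a small partition
function. -/
theorem IsTreeField.measureReal_partitionFunction_le [IsProbabilityMeasure P]
    (h : IsTreeField (k + n) V P X) {β θ t lam q : ℝ} (hlam : 0 ≤ lam)
    (hq : ∀ u : Fin k → Bool, P.real {ω | partitionFunction (CREM.subtreeField X u) β ω ≤ θ} ≤ q) :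
    P.real {ω | partitionFunction X β ω ≤ Real.exp (-t) * θ} ≤
      q ^ 2 ^ k + 2 ^ k * Real.exp (-lam * t + lam ^ 2 * β ^ 2 * V k / 2) := by
  set S : (Fin k → Bool) → Set Ω := fun u =>
    {ω | partitionFunction (CREM.subtreeField X u) β ω ≤ θ} with hS
  set L : (Fin k → Bool) → Set Ω := fun u => {ω | β * X (graft u (root n)) ω ≤ -t} with hL
  -- A single subtree whose root is above the low level and whose partition function exceeds `θ`
  -- already makes the whole sum large. The two events are combined by a union bound, so no
  -- independence between root values and subtrees is needed.
  have hsub : {ω | partitionFunction X β ω ≤ Real.exp (-t) * θ} ⊆ (⋂ u, S u) ∪ ⋃ u, L u := by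
    intro ω hω
    by_cases hex : ω ∈ ⋃ u, L u
    · exact Or.inr hex
    · refine Or.inl (mem_iInter.2 fun u => ?_)
      have hu : -t < β * X (graft u (root n)) ω := by
        by_contra hcon
        exact hex (mem_iUnion.2 ⟨u, not_lt.1 hcon⟩)
      have hSnn : ∀ u, 0 ≤ partitionFunction (CREM.subtreeField X u) β ω := fun u =>
        Finset.sum_nonneg fun _ _ => (Real.exp_pos _).le
      have h1 : Real.exp (β * X (graft u (root n)) ω) *
          partitionFunction (CREM.subtreeField X u) β ω ≤ Real.exp (-t) * θ := by
        refine le_trans ?_ (show partitionFunction X β ω ≤ Real.exp (-t) * θ from hω)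
        rw [partitionFunction_eq_sum_subtree]
        exact Finset.single_le_sum (f := fun u => Real.exp (β * X (graft u (root n)) ω) *
          partitionFunction (CREM.subtreeField X u) β ω)
          (fun u _ => mul_nonneg (Real.exp_pos _).le (hSnn u)) (Finset.mem_univ u)
      have h2 : Real.exp (-t) * partitionFunction (CREM.subtreeField X u) β ω ≤
          Real.exp (β * X (graft u (root n)) ω) *
          partitionFunction (CREM.subtreeField X u) β ω :=
        mul_le_mul_of_nonneg_right (Real.exp_le_exp.2 hu.le) (hSnn u)
      exact le_of_mul_le_mul_left (h2.trans h1) (Real.exp_pos _)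
  have hcard : Fintype.card (Fin k → Bool) = 2 ^ k := by simp
  have hinter : P.real (⋂ u, S u) ≤ q ^ 2 ^ k := by
    have hind := h.iIndepFun_subtreeField.measure_inter_preimage_eq_mul Finset.univ
      (sets := fun _ => {y : Tree n → ℝ | ∑ w : Fin n → Bool, Real.exp (β * y (leaf w)) ≤ θ})
      fun _ _ => measurableSet_le (measurable_sum_exp_leaf β) measurable_const
    have hreal : P.real (⋂ u, S u) = ∏ u, P.real (S u) := by
      simp only [Measure.real, ← ENNReal.toReal_prod]
      congr 1
      simpa [hS, partitionFunction] using hind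
    rw [hreal, ← hcard, ← Finset.card_univ, ← Finset.prod_const]
    exact Finset.prod_le_prod (fun _ _ => measureReal_nonneg) fun u _ => hq u
  have hlow : ∀ u, P.real (L u) ≤ Real.exp (-lam * t + lam ^ 2 * β ^ 2 * V k / 2) := by
    intro u
    have hm := h.exp_moment_single (-lam * β) (graft u (root n))
    have hch := measure_ge_le_exp_mul_mgf (μ := P) (X := fun ω => -(β * X (graft u (root n)) ω)) t
      hlam (by simpa [mul_assoc] using hm.1)
    have hset : L u = {ω | t ≤ -(β * X (graft u (root n)) ω)} := by
      ext ω; simp only [hL, Set.mem_ofPred_eq]; constructor <;> intro <;> linarith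
    have hmgf : mgf (fun ω => -(β * X (graft u (root n)) ω)) P lam =
        Real.exp (lam ^ 2 * β ^ 2 * V k / 2) := by
      rw [mgf]
      convert hm.2 using 1
      · simp [mul_assoc]
      · simp [graft, root, mul_pow]
    rw [hset]
    refine hch.trans_eq ?_
    rw [hmgf, ← Real.exp_add]
  calc _ ≤ P.real ((⋂ u, S u) ∪ ⋃ u, L u) := measureReal_mono hsub
    _ ≤ P.real (⋂ u, S u) + P.real (⋃ u, L u) := measureReal_union_le _ _
    _ ≤ q ^ 2 ^ k + ∑ u : Fin k → Bool, P.real (L u) :=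
        add_le_add hinter (measureReal_iUnion_fintype_le _)
    _ ≤ q ^ 2 ^ k + ∑ _u : Fin k → Bool, Real.exp (-lam * t + lam ^ 2 * β ^ 2 * V k / 2) := by
        gcongr with u; exact hlow u
    _ = _ := by
        rw [Finset.sum_const, Finset.card_univ, hcard, nsmul_eq_mul]; push_cast; rfl

end Subtree

lemma IsTreeField.integral_partitionFunction {n : ℕ} {V : ℕ → ℝ} {Ω : Type*} [MeasurableSpace Ω]
    {P : Measure Ω} {X : Tree n → Ω → ℝ} (h : IsTreeField n V P X) (β : ℝ) :
    ∫ ω, partitionFunction X β ω ∂P = 2 ^ n * Real.exp (β ^ 2 * V n / 2) := by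
  simp only [partitionFunction]
  rw [integral_finsetSum _ fun w _ => (h.exp_moment_single β (leaf w)).1]
  simp_rw [fun w : Fin n → Bool => (h.exp_moment_single β (leaf w)).2]
  simp [leaf]

/-! ### The sequences -/

lemma decaysDoublyExponentially_of_le {u : ℕ → ℝ} {C c g : ℝ} (hC : 0 < C) (hc : 0 < c)
    (hg : 1 < g) (hu : ∀ k, |u k| ≤ C * Real.exp (-c * g ^ k)) : DecaysDoublyExponentially u := by
  have hlog : 0 < Real.log g := Real.log_pos hg
  -- The definition uses one constant both as prefactor and as growth rate, hence the minimum.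
  refine ⟨C, hC, min c (Real.log g), lt_min hc hlog, fun k => (hu k).trans ?_⟩
  have h1 : Real.exp (min c (Real.log g) * k) ≤ g ^ k := by
    calc _ ≤ Real.exp (Real.log g * k) := by gcongr; exact min_le_right _ _
      _ = g ^ k := by rw [mul_comm, Real.exp_nat_mul, Real.exp_log (by linarith)]
  have h2 : min c (Real.log g) * Real.exp (min c (Real.log g) * k) ≤ c * g ^ k :=
    mul_le_mul (min_le_left _ _) h1 (Real.exp_pos _).le hc.le
  refine mul_le_mul_of_nonneg_left (Real.exp_le_exp.2 ?_) hC.le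
  linarith

lemma summable_exp_sq_sub_pow {K κ g : ℝ} (hK : 0 ≤ K) (hκ : 0 < κ) (hg : 1 < g) :
    Summable fun r : ℕ => Real.exp (K * ((r : ℝ) + 2) ^ 2 - κ * g ^ r) := by
  have hlim := tendsto_pow_const_div_const_pow_of_one_lt 2 hg
  -- With this threshold, eventually `κ * g ^ r > (4 * K + 1) * r ^ 2`, while `K * (r + 2) ^ 2 ≤ 4 *
  -- K * r ^ 2` for `r ≥ 2`; the exponent is then below `-r ^ 2 ≤ -r`.
  have hev := hlim.eventually (gt_mem_nhds (show 0 < κ / (4 * K + 1) by positivity))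
  refine Summable.of_norm_bounded_eventually_nat (g := fun r : ℕ => Real.exp (-(r : ℝ)))
    Real.summable_exp_neg_nat ?_
  filter_upwards [hev, Filter.eventually_ge_atTop 2] with r hr hr2
  have hr2' : (2 : ℝ) ≤ r := by exact_mod_cast hr2
  have hgr : 0 < g ^ r := pow_pos (by linarith) r
  rw [Real.norm_of_nonneg (Real.exp_pos _).le, Real.exp_le_exp]
  rw [div_lt_div_iff₀ hgr (by positivity)] at hr
  have h1 : K * ((r : ℝ) + 2) ^ 2 ≤ K * (4 * (r : ℝ) ^ 2) := by
    refine mul_le_mul_of_nonneg_left ?_ hK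
    nlinarith
  nlinarith

/-- Completing the square: the doubly exponential gain beats the loss. -/
lemma mul_sqrt_pow_sub_mul_pow_le {B κ γ : ℝ} (hB : 0 ≤ B) (hκ : 0 < κ) (hγ : γ ∈ Ioo (11 / 10 : ℝ) 2) (r : ℕ) :
    B * ((r : ℝ) + 2) * √γ ^ (r + 1) - κ * γ ^ r ≤
      2 * B ^ 2 / κ * ((r : ℝ) + 2) ^ 2 - κ / 2 * (11 / 10) ^ r := by
  have hγ0 : 0 ≤ γ := by linarith [hγ.1]
  have hsq : √γ ≤ 2 := by
    rw [Real.sqrt_le_left (by norm_num)]; linarith [hγ.2]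
  have hx : (√γ ^ r) ^ 2 = γ ^ r := by rw [← pow_mul, mul_comm, pow_mul, Real.sq_sqrt hγ0]
  have hpow : (11 / 10 : ℝ) ^ r ≤ γ ^ r := pow_le_pow_left₀ (by norm_num) hγ.1.le r
  set x := √γ ^ r
  have hx0 : 0 ≤ x := by positivity
  have h1 : B * ((r : ℝ) + 2) * √γ ^ (r + 1) ≤ B * ((r : ℝ) + 2) * (x * 2) := by
    rw [pow_succ]; gcongr
  have h2 : 0 ≤ κ / 2 * (x - 2 * B * ((r : ℝ) + 2) / κ) ^ 2 := by positivity
  have h3 : κ / 2 * (x - 2 * B * ((r : ℝ) + 2) / κ) ^ 2 =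
      κ / 2 * x ^ 2 - B * ((r : ℝ) + 2) * (x * 2) + 2 * B ^ 2 / κ * ((r : ℝ) + 2) ^ 2 := by
    field_simp; ring
  nlinarith

lemma two_log_two_of_lt_criticalBeta {A : ℝ → ℝ} {β : ℝ} (hβ0 : 0 ≤ β) (hβ : β < criticalBeta A)
    (ha : 0 < hullSlope A) : β ^ 2 * hullSlope A < 2 * Real.log 2 := by
  have hlog : 0 ≤ 2 * Real.log 2 := by positivity
  rw [criticalBeta, lt_div_iff₀ (Real.sqrt_pos.2 ha)] at hβ
  have := pow_lt_pow_left₀ hβ (by positivity) two_ne_zero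
  rwa [mul_pow, Real.sq_sqrt ha.le, Real.sq_sqrt hlog] at this

/-- The one-step bound with the thresholds used for the sequences. -/
lemma IsTreeField.measureReal_le_rpow {k n : ℕ} {V : ℕ → ℝ} {Ω : Type*} [MeasurableSpace Ω]
    {P : Measure Ω} [IsProbabilityMeasure P] {X : Tree (k + n) → Ω → ℝ}
    (h : IsTreeField (k + n) V P X) {β a p γ : ℝ} (ha : 0 ≤ a) (hp : p ∈ Ioo (0 : ℝ) 1)
    (hγ : γ ∈ Ioo (11 / 10 : ℝ) 2) (hV : V k ≤ a * k)
    (hsub : ∀ u : Fin k → Bool, P.real {ω | partitionFunction (CREM.subtreeField X u) β ω ≤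
      1 / 4 * (2 ^ n * Real.exp (β ^ 2 * (V (k + n) - V k) / 2))} ≤ 1 - p) :
    P.real {ω | partitionFunction X β ω ≤
      1 / 4 * Real.exp (-(β ^ 2 * a + 2 * Real.log 2 - Real.log (p / 2)) * (k + 1) * √γ ^ k) *
        ∫ ω', partitionFunction X β ω' ∂P} ≤ (1 - p / 2) ^ (γ ^ k) := by
  have hγ0 : 0 ≤ γ := by linarith [hγ.1]
  have hp0 := hp.1
  have hg1 : 1 ≤ √γ := Real.one_le_sqrt.2 (by linarith [hγ.1])
  have hx1 : 1 ≤ √γ ^ k := one_le_pow₀ hg1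
  have hx2 : (√γ ^ k) ^ 2 = γ ^ k := by rw [← pow_mul, mul_comm, pow_mul, Real.sq_sqrt hγ0]
  have hγk : 1 ≤ γ ^ k := one_le_pow₀ (by linarith [hγ.1])
  set x := √γ ^ k with hx
  have hlog2 : 0 < Real.log 2 := Real.log_pos one_lt_two
  have hlogp : Real.log (p / 2) < 0 := Real.log_neg (by linarith) (by linarith [hp.2])
  set c1 := β ^ 2 * a / 2 + Real.log 2 with hc1
  set c2 := -Real.log (p / 2) with hc2
  have hc1' : 0 ≤ c1 := by positivity
  have hβa : 0 ≤ β ^ 2 * a := by positivity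
  have hk0 : (0 : ℝ) ≤ k := Nat.cast_nonneg k
  have h2k : (2 : ℝ) ^ k = Real.exp (k * Real.log 2) := by
    rw [Real.exp_nat_mul, Real.exp_log two_pos]
  have hVβ : β ^ 2 * V k ≤ β ^ 2 * (a * k) := mul_le_mul_of_nonneg_left hV (sq_nonneg β)
  -- With Chernoff parameter `x = √γ ^ k`, every term of the exponent is at most of scale `x ^ 2 = γ
  -- ^ k`. The part `c1 * k` absorbs the variance and the `2 ^ k` vertices, and `c2` leaves exactly
  -- `(p / 2) ^ (γ ^ k)`.
  set t := x * (c1 * k + c2) with ht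
  refine (measureReal_mono ?_).trans ((h.measureReal_partitionFunction_le (t := t) (lam := x)
    (by linarith) hsub).trans ?_)
  · intro ω hω
    rw [Set.mem_ofPred_eq] at hω ⊢
    refine hω.trans ?_
    rw [h.integral_partitionFunction, pow_add, h2k]
    -- The mean of the whole tree exceeds that of a subtree by a factor of at most `exp (c1 * k)`.
    -- The rate in the exponent is `2 * c1 + c2`: one `c1` pays for this factor, while `c1` and `c2`
    -- pay for `t`.
    have : Real.exp (-(β ^ 2 * a + 2 * Real.log 2 - Real.log (p / 2)) * (k + 1) * x) *
        (Real.exp (k * Real.log 2) * Real.exp (β ^ 2 * V (k + n) / 2)) ≤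
        Real.exp (-t) * Real.exp (β ^ 2 * (V (k + n) - V k) / 2) := by
      rw [← Real.exp_add, ← Real.exp_add, ← Real.exp_add, Real.exp_le_exp]
      have e1 : c1 * k ≤ c1 * k * x := le_mul_of_one_le_right (by positivity) hx1
      have e2 : 0 ≤ (c2 * k + 2 * c1) * x := by
        have : 0 < c2 := by linarith
        positivity
      have e3 : (β ^ 2 * a + 2 * Real.log 2 - Real.log (p / 2)) * (k + 1) * x =
          t + c1 * k * x + (c2 * k + 2 * c1) * x := by
        rw [ht, hc1, hc2]; ring
      have e4 : c1 * k = β ^ 2 * (a * k) / 2 + k * Real.log 2 := by rw [hc1]; ring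
      linarith
    calc _ = 1 / 4 * 2 ^ n *
        (Real.exp (-(β ^ 2 * a + 2 * Real.log 2 - Real.log (p / 2)) * (k + 1) * x) *
          (Real.exp (k * Real.log 2) * Real.exp (β ^ 2 * V (k + n) / 2))) := by ring
      _ ≤ 1 / 4 * 2 ^ n * (Real.exp (-t) * Real.exp (β ^ 2 * (V (k + n) - V k) / 2)) := by gcongr
      _ = _ := by ring
  · have h1 : (1 - p) ^ 2 ^ k ≤ (1 - p) ^ (γ ^ k) := by
      rw [← Real.rpow_natCast]
      refine Real.rpow_le_rpow_of_exponent_ge (by linarith [hp.2]) (by linarith) ?_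
      push_cast
      exact pow_le_pow_left₀ hγ0 hγ.2.le k
    have h2 : 2 ^ k * Real.exp (-x * t + x ^ 2 * β ^ 2 * V k / 2) ≤ (p / 2) ^ (γ ^ k) := by
      rw [Real.rpow_def_of_pos (by positivity), h2k, ← Real.exp_add, Real.exp_le_exp, ht]
      have e1 : k * Real.log 2 ≤ γ ^ k * (k * Real.log 2) :=
        le_mul_of_one_le_left (by positivity) hγk
      have e2 : γ ^ k * (β ^ 2 * V k) ≤ γ ^ k * (β ^ 2 * (a * k)) := by gcongr
      have e3 : -x * (x * (c1 * k + c2)) = -(γ ^ k * (c1 * k + c2)) := by rw [← hx2]; ring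
      rw [e3, hx2, hc1, hc2]
      linarith
    -- Superadditivity of `y ↦ y ^ m` for `m ≥ 1` merges both errors into one power; this is why `η₀
    -- = 1 - p / 2`.
    calc _ ≤ (1 - p) ^ (γ ^ k) + (p / 2) ^ (γ ^ k) := add_le_add h1 h2
      _ ≤ (1 - p + p / 2) ^ (γ ^ k) :=
          Real.add_rpow_le_rpow_add (by linarith [hp.2]) (by positivity) hγk
      _ = _ := by congr 1; ring

end CREM

theorem proposition3p1 (A : ℝ → ℝ) (hA : CREM.IsProfile A)
    (β : ℝ) (hβ_nonneg : 0 ≤ β) (hβ : β < CREM.criticalBeta A) :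
    ∃ N₀ : ℕ, ∃ η₀ ∈ Set.Ioo (0 : ℝ) 1, ∃ C : ℝ → ℝ, (∀ s > 0, 0 < C s) ∧
      ∀ γ ∈ Set.Ioo (11 / 10 : ℝ) 2, ∃ ε η : ℕ → ℝ,
        (∀ k, 0 < ε k) ∧ CREM.DecaysDoublyExponentially ε ∧
        (∀ k, η k = η₀ ^ (γ ^ k)) ∧ CREM.DecaysDoublyExponentially η ∧
        (∀ N : ℕ, N₀ ≤ N → ∀ k ≤ CREM.numSteps γ N,
          ∀ (Ω : Type*) [MeasurableSpace Ω] (P : MeasureTheory.Measure Ω)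
            [MeasureTheory.IsProbabilityMeasure P] (X : CREM.Tree N → Ω → ℝ),
            CREM.IsCREM A N P X →
              P.real {ω | CREM.partitionFunction X β ω ≤
                ε k * ∫ ω', CREM.partitionFunction X β ω' ∂P} ≤ η k) ∧
        (∀ s > 0, ∀ N : ℕ,
          ∑ r ∈ Finset.range (CREM.numSteps γ N), (ε (r + 1)) ^ (-s) * η r ≤ C s) := by
  have ha1 := hA.one_le_hullSlope
  have ha0 : 0 < CREM.hullSlope A := by linarith
  have hcrit := CREM.two_log_two_of_lt_criticalBeta hβ_nonneg hβ ha0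
  set a := CREM.hullSlope A with ha
  set gap := Real.log 2 - β ^ 2 * a / 2 with hgap
  have hgap0 : 0 < gap := by linarith
  -- The subcritical gap is shared between the excess slope `d` and the barrier slope `δ`, each
  -- costing less than half; the added `1` covers `β = 0`.
  set d := gap / (β ^ 2 + 1) with hd
  have hd0 : 0 < d := by positivity
  set δ := gap / (2 * (β + 1)) with hδ
  have hδ0 : 0 < δ := by positivity
  have hsub : β ^ 2 * (a + d) / 2 + β * δ < Real.log 2 := by
    have h1 : β ^ 2 * d < gap := by
      rw [hd, mul_div_assoc', div_lt_iff₀ (by positivity)]; nlinarith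
    have h2 : β * δ < gap / 2 := by
      rw [hδ, mul_div_assoc', div_lt_iff₀ (by positivity)]; nlinarith
    linarith
  obtain ⟨p, hp, hbase⟩ :=
    CREM.exists_measureReal_le_quarter_le hβ_nonneg (add_pos ha0 hd0) hδ0 hsub
  obtain ⟨N₀, hN₀, hvar⟩ := hA.exists_variance_increment_le hd0
  have hp0 := hp.1
  have hη₀ : 1 - p / 2 ∈ Set.Ioo (0 : ℝ) 1 := ⟨by linarith [hp.2], by linarith⟩
  set κ := -Real.log (1 - p / 2) with hκ
  have hκ0 : 0 < κ := by linarith [Real.log_neg hη₀.1 hη₀.2]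
  set D := β ^ 2 * a + 2 * Real.log 2 - Real.log (p / 2) with hD
  have hD0 : 0 < D := by
    have h1 : Real.log (p / 2) < 0 := Real.log_neg (by linarith) (by linarith [hp.2])
    have h2 : 0 ≤ β ^ 2 * a := by positivity
    have h3 : 0 < Real.log 2 := Real.log_pos one_lt_two
    linarith
  -- A majorant of the summands without their factor `(1 / 4) ^ (-s)`. It has `11 / 10` in place of
  -- `γ`, so the constant `C s` serves all `γ` at once.
  set F : ℝ → ℕ → ℝ := fun s r =>
    Real.exp (2 * (s * D) ^ 2 / κ * ((r : ℝ) + 2) ^ 2 - κ / 2 * (11 / 10) ^ r) with hF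
  have hFsum : ∀ s, Summable (F s) := fun s =>
    CREM.summable_exp_sq_sub_pow (by positivity) (by positivity) (by norm_num)
  have hηexp : ∀ (γ : ℝ) (k : ℕ), (1 - p / 2) ^ (γ ^ k) = Real.exp (-κ * γ ^ k) := fun γ k => by
    rw [Real.rpow_def_of_pos hη₀.1, hκ, neg_neg]
  refine ⟨N₀, 1 - p / 2, hη₀, fun s => (1 / 4) ^ (-s) * ∑' r, F s r, fun s _ =>
    mul_pos (by positivity) ((hFsum s).tsum_pos (fun r => (Real.exp_pos _).le) 0 (Real.exp_pos _)),
    fun γ hγ => ?_⟩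
  have hg1 : 1 < √γ := Real.lt_sqrt_of_sq_lt (by linarith [hγ.1])
  refine ⟨fun k => 1 / 4 * Real.exp (-D * (k + 1) * √γ ^ k), fun k => (1 - p / 2) ^ (γ ^ k),
    fun k => by positivity, ?_, fun k => rfl, ?_, ?_, ?_⟩
  · refine CREM.decaysDoublyExponentially_of_le (C := 1 / 4) (by norm_num) hD0 hg1 fun k => ?_
    rw [abs_of_nonneg (by positivity)]
    gcongr
    nlinarith [mul_nonneg hD0.le (Nat.cast_nonneg (α := ℝ) k)]
  · refine CREM.decaysDoublyExponentially_of_le (C := 1) one_pos hκ0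
      (show 1 < γ by linarith [hγ.1]) fun k => ?_
    rw [hηexp, abs_of_nonneg (Real.exp_pos _).le, one_mul]
  · intro N hN k hk Ω _ P _ X hX
    obtain ⟨hkN, hinc⟩ := hvar N hN γ hγ.1 k hk
    have hN0 : (0 : ℝ) < N := by exact_mod_cast hN₀.trans hN
    obtain ⟨n, rfl⟩ := Nat.exists_eq_add_of_le hkN
    refine hX.isTreeField.measureReal_le_rpow ha0.le hp hγ ?_ fun u => ?_
    · have hk1 : (k : ℝ) / (k + n : ℕ) ∈ Set.Icc (0 : ℝ) 1 :=
        ⟨by positivity, (div_le_one hN0).2 (by exact_mod_cast hkN)⟩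
      calc _ ≤ ((k + n : ℕ) : ℝ) * (a * ((k : ℝ) / (k + n : ℕ))) :=
            mul_le_mul_of_nonneg_left (hA.le_hullSlope_mul hk1) hN0.le
        _ = a * k := by field_simp
    · have hV : ∀ l ≤ n, ((k + n : ℕ) : ℝ) * A (((k + l : ℕ) : ℝ) / (k + n : ℕ)) -
          ((k + n : ℕ) : ℝ) * A ((k : ℝ) / (k + n : ℕ)) ≤ (a + d) * l :=
        fun l hl => hinc l (by omega)
      -- The constant-scale bound is applied to the subtree with its own variance profile; since `p`
      -- was fixed before the profile, it is the same for all `k`, `N` and `γ`.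
      have hfield := hX.isTreeField.subtreeField u
      have hsmall := hbase n _ Ω P _ hfield hV
      exact hsmall
  · intro s hs N
    beta_reduce
    rw [← tsum_mul_left]
    refine le_trans (Finset.sum_le_sum fun r _ => ?_)
      (((hFsum s).mul_left _).sum_le_tsum _ fun r _ => by positivity)
    have h1 : (1 / 4 * Real.exp (-D * ((r + 1 : ℕ) + 1) * √γ ^ (r + 1))) ^ (-s) =
        (1 / 4) ^ (-s) * Real.exp (s * D * ((r : ℝ) + 2) * √γ ^ (r + 1)) := by
      rw [Real.mul_rpow (by norm_num) (Real.exp_pos _).le, ← Real.exp_mul]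
      congr 2
      push_cast; ring
    rw [h1, hηexp, mul_assoc, ← Real.exp_add]
    refine mul_le_mul_of_nonneg_left (Real.exp_le_exp.2 ?_) (by positivity)
    have := CREM.mul_sqrt_pow_sub_mul_pow_le (mul_pos hs hD0).le hκ0 hγ r
    linarith
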